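/- Throughout, $2$-categories, $2$-functors and $2$-natural transformations are strict. Let $P,A,B,C$ be $2$-categories, let $p:P\to A$, $q:P\to B$, $f:A\to C$, $g:B\to C$ be $2$-functors, and let $\phi: fp\Rightarrow gq$ be a $2$-natural transformation (a lax square of $2$-categories). For a category $X$ let $\pi_0X$ be its set of connected components; a functor is *inverted by $\pi_0$* if it induces a bijection between these sets. For a $2$-category $X$ let $\pi_{0*}X$ be the category with the same objects and with $(\pi_{0*}X)(x,y)=\pi_0(X(x,y))$; this is functorial in $2$-functors and $2$-natural transformations, so the lax square has an image under $\pi_{0*}$, which is a lax square of categories. A lax square of categories $(p,q,f,g,\phi:fp\Rightarrow gq)$ is *exact* if for all objects $a$ of $A$ and $b$ of $B$ the function $$\tilde\phi_{a,b}:\int^{x\in P}B(qx,b)\times A(a,px)\longrightarrow C(fa,gb)$$ induced by $(\beta,\alpha)\mapsto g\beta\circ\phi_x\circ f\alpha$ is a bijection. The given lax square of $2$-categories is *$\pi_0$-exact* if its image under $\pi_{0*}$ is an exact lax square of categories. For objects $a$ of $A$ and $b$ of $B$ let $\mathcal F(\phi,a,b)$ be the following category. Its objects are triples $(x,y,z)$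 with $x$ an object of $P$ and $y:qx\to b$ and $z:a\to px$ $1$-cells. A morphism $(x_1,y_1,z_1)\to(x_2,y_2,z_2)$ is a triple $(h,h_1,h_2)$ of a $1$-cell $h:x_1\to x_2$ of $P$ and $2$-cells $h_1:y_1\Rightarrow y_2\circ q(h)$ and $h_2:p(h)\circ z_1\Rightarrow z_2$; identities are given by identity cells and composition by pasting. Let $$\mathcal C(\phi,a,b):\mathcal F(\phi,a,b)\longrightarrow C(fa,gb)$$ be the functor into the hom-category which is given on objects by $(x,y,z)\mapsto g(y)\circ\phi_x\circ f(z)$, and which sends $(h,h_1,h_2)$ to the composite $2$-cell $$g(y_1)\,\phi_{x_1}\,f(z_1)\;\Rightarrow\; g(y_2)\,gq(h)\,\phi_{x_1}\,f(z_1)\;=\;g(y_2)\,\phi_{x_2}\,fp(h)\,f(z_1)\;\Rightarrow\; g(y_2)\,\phi_{x_2}\,f(z_2)$$ whose two arrows are obtained by whiskering $g(h_1)$ and $f(h_2)$. **Proposition.** The lax square is $\pi_0$-exact if and only if, for all objects $a$ of $A$ and $b$ of $B$, the functor $\mathcal C(\phi,a,b)$ is inverted by $\pi_0$. -/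

import Mathlib

/-!
# π₀-exact lax squares of 2-categories

A 2-category is a Mathlib bicategory that is `Bicategory.Strict`, a 2-functor is a
`StrictPseudofunctor`. In a diagram of the form
```
        q
    P ------> B
    |         |
  p |   φ ⇒   | g
    v         v
    A ------> C
        f
```
`φ` is a 2-natural transformation from `f ∘ p` to `g ∘ q`. Composition is written in diagrammatic
order, so that for instance `g(y) ∘ φ_x ∘ f(z)` is `f.map z ≫ φ.app x ≫ g.map y`.
-/

open CategoryTheory Bicategory

universe w₁ w₂ w₃ w₄ v₁ v₂ v₃ v₄ u₁ u₂ u₃ u₄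

namespace PiZeroExact

section PiZeroStar

/-- The category `π₀⁎ X` obtained from a 2-category `X` by applying `π₀` to the homs:
it has the objects of `X`, and a morphism is a connected component of a hom-category of `X`. -/
structure PiZeroStar (X : Type u₁) where
  /-- The underlying object of the 2-category. -/
  as : X

namespace PiZeroStar

/-- The connected component of a 1-cell. -/
abbrev cc {X : Type u₁} [Bicategory.{w₁, v₁} X] {x y : X} (h : x ⟶ y) :
    CategoryTheory.ConnectedComponents (x ⟶ y) :=
  CategoryTheory.ConnectedComponents.mk h

variable {X : Type u₁} [Bicategory.{w₁, v₁} X]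

/-- Composition of connected components of 1-cells. -/
def compCC {x y z : X} (s : CategoryTheory.ConnectedComponents (x ⟶ y)) (t : CategoryTheory.ConnectedComponents (y ⟶ z)) :
    CategoryTheory.ConnectedComponents (x ⟶ z) :=
  Quotient.map₂ (fun (h : x ⟶ y) (k : y ⟶ z) => h ≫ k)
    (fun h h' (hh : Zigzag h h') k k' (hk : Zigzag k k') =>
      (zigzag_obj_of_zigzag (postcomp x k) hh).trans
        (zigzag_obj_of_zigzag (precomp z h') hk)) s t

instance [Strict X] : Category.{v₁} (PiZeroStar X) where
  Hom x y := CategoryTheory.ConnectedComponents (x.as ⟶ y.as)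
  id x := cc (𝟙 x.as)
  comp s t := compCC s t
  id_comp := by
    rintro x y ⟨h⟩
    exact congrArg cc (Strict.id_comp h)
  comp_id := by
    rintro x y ⟨h⟩
    exact congrArg cc (Strict.comp_id h)
  assoc := by
    rintro x y z t ⟨h⟩ ⟨k⟩ ⟨l⟩
    exact congrArg cc (Strict.assoc h k l)

variable [Strict X] {Y : Type u₂} [Bicategory.{w₂, v₂} Y] [Strict Y]

/-- The action of `π₀⁎` on 2-functors. -/
def map (F : StrictPseudofunctor X Y) : PiZeroStar X ⥤ PiZeroStar Y where
  obj x := ⟨F.obj x.as⟩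
  map {x y} s := (F.mapFunctor x.as y.as).mapConnectedComponents s
  map_id x := congrArg cc (F.map_id x.as)
  map_comp := by
    rintro x y z ⟨h⟩ ⟨k⟩
    exact congrArg cc (F.map_comp h k)

end PiZeroStar

end PiZeroStar

section ExactSquare

variable {P : Type u₁} [Category.{v₁} P] {A : Type u₂} [Category.{v₂} A]
  {B : Type u₃} [Category.{v₃} B] {C : Type u₄} [Category.{v₄} C]
  {p : P ⥤ A} {q : P ⥤ B} {f : A ⥤ C} {g : B ⥤ C}

/-- The relation which presents the coend `∫^x B(qx,b) × A(a,px)` as a quotient of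
`Σ x, B(qx,b) × A(a,px)`: for `h : x₁ ⟶ x₂` in `P`, `β : q x₂ ⟶ b` and `α : a ⟶ p x₁`, the
elements `(β ∘ qh, α)` at `x₁` and `(β, ph ∘ α)` at `x₂` are identified. -/
inductive CoendRel (p : P ⥤ A) (q : P ⥤ B) (a : A) (b : B) :
    (Σ x : P, (q.obj x ⟶ b) × (a ⟶ p.obj x)) → (Σ x : P, (q.obj x ⟶ b) × (a ⟶ p.obj x)) → Prop
  | intro {x₁ x₂ : P} (h : x₁ ⟶ x₂) (β : q.obj x₂ ⟶ b) (α : a ⟶ p.obj x₁) :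
      CoendRel p q a b ⟨x₁, (q.map h ≫ β, α)⟩ ⟨x₂, (β, α ≫ p.map h)⟩

/-- The value at `(a, b)` of the composite profunctor `B(q,1) ∘ A(1,p)`, that is the coend
`∫^x B(qx,b) × A(a,px)` in sets. -/
def ProfComp (p : P ⥤ A) (q : P ⥤ B) (a : A) (b : B) : Type (max u₁ v₂ v₃) :=
  Quot (CoendRel p q a b)

/-- The component at `(a, b)` of the 2-cell of profunctors
`φ̃ : B(q,1) ∘ A(1,p) ⟶ C(f,g)` which corresponds to `φ : f ∘ p ⟶ g ∘ q`. It is induced by the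
dinatural family `(β, α) ↦ g β ∘ φ_x ∘ f α`. -/
def profTrans (φ : p ⋙ f ⟶ q ⋙ g) (a : A) (b : B) :
    ProfComp p q a b → (f.obj a ⟶ g.obj b) :=
  Quot.lift (fun s => f.map s.2.2 ≫ φ.app s.1 ≫ g.map s.2.1) (by
    rintro _ _ ⟨h, β, α⟩
    have := φ.naturality h
    dsimp at this ⊢
    simp only [Functor.map_comp, Category.assoc]
    rw [reassoc_of% this])

/-- A lax square in `Cat` is exact when `φ̃` is an isomorphism of profunctors, that is,
bijective in each component. -/
def IsExact (φ : p ⋙ f ⟶ q ⋙ g) : Prop :=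
  ∀ (a : A) (b : B), Function.Bijective (profTrans φ a b)

end ExactSquare

/-- A functor is inverted by `π₀ : Cat ⥤ Set` when it induces a bijection between the sets of
connected components. -/
def InvertedByPiZero {X : Type u₁} [Category.{v₁} X] {Y : Type u₂} [Category.{v₂} Y]
    (F : X ⥤ Y) : Prop :=
  Function.Bijective F.mapConnectedComponents

section LaxSquare

/-- A lax square of 2-categories with boundary the 2-functors `p`, `q`, `f`, `g`: a 2-natural
transformation `φ` from `f ∘ p` to `g ∘ q`, that is, a family of 1-cells `app x` which is strictly
natural with respect to 1-cells and compatible with 2-cells. -/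
structure LaxSquare {P : Type u₁} [Bicategory.{w₁, v₁} P] {A : Type u₂} [Bicategory.{w₂, v₂} A]
    {B : Type u₃} [Bicategory.{w₃, v₃} B] {C : Type u₄} [Bicategory.{w₄, v₄} C]
    (p : StrictPseudofunctor P A) (q : StrictPseudofunctor P B)
    (f : StrictPseudofunctor A C) (g : StrictPseudofunctor B C) where
  /-- The components `φ_x`. -/
  app (x : P) : f.obj (p.obj x) ⟶ g.obj (q.obj x)
  /-- Naturality with respect to 1-cells, as an equality of 1-cells. -/
  naturality {x y : P} (h : x ⟶ y) :
    f.map (p.map h) ≫ app y = app x ≫ g.map (q.map h)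
  /-- Naturality with respect to 2-cells. The `eqToHom`s are the identity 2-cells which come from
  the naturality with respect to 1-cells. -/
  naturality₂ {x y : P} {h k : x ⟶ y} (η : h ⟶ k) :
    f.map₂ (p.map₂ η) ▷ app y =
      eqToHom (naturality h) ≫ app x ◁ g.map₂ (q.map₂ η) ≫ eqToHom (naturality k).symm

variable {P : Type u₁} [Bicategory.{w₁, v₁} P] {A : Type u₂} [Bicategory.{w₂, v₂} A]
  {B : Type u₃} [Bicategory.{w₃, v₃} B] {C : Type u₄} [Bicategory.{w₄, v₄} C]
  {p : StrictPseudofunctor P A} {q : StrictPseudofunctor P B}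
  {f : StrictPseudofunctor A C} {g : StrictPseudofunctor B C}

/-- The image under `π₀⁎` of (the 2-cell of) a lax square of 2-categories: its component at `x` is
the connected component of `φ_x`. -/
def piZeroStarSquare [Strict P] [Strict A] [Strict B] [Strict C]
    (φ : LaxSquare p q f g) :
    PiZeroStar.map p ⋙ PiZeroStar.map f ⟶ PiZeroStar.map q ⋙ PiZeroStar.map g where
  app x := PiZeroStar.cc (φ.app x.as)
  naturality := by
    rintro x y ⟨h⟩
    exact congrArg PiZeroStar.cc (φ.naturality h)

/-- A lax square of 2-categories is `π₀`-exact when its image under `π₀⁎` is exact in `Cat`. -/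
def IsPiZeroExact [Strict P] [Strict A] [Strict B] [Strict C]
    (φ : LaxSquare p q f g) : Prop :=
  IsExact (piZeroStarSquare φ)

/-- The objects of the category `ℱ(φ,a,b)`: triples `(x, y : q x ⟶ b, z : a ⟶ p x)`. -/
structure FactObj (p : StrictPseudofunctor P A) (q : StrictPseudofunctor P B) (a : A) (b : B) where
  /-- The object of `P`. -/
  x : P
  /-- The 1-cell of `B`. -/
  y : q.obj x ⟶ b
  /-- The 1-cell of `A`. -/
  z : a ⟶ p.obj x

namespace FactObj

variable {a : A} {b : B}

/-- The morphisms of the category `ℱ(φ,a,b)`: triples consisting of a 1-cell `h : x₁ ⟶ x₂` of `P`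
and of 2-cells `h₁ : y₁ ⇒ y₂ ∘ q h` and `h₂ : p h ∘ z₁ ⇒ z₂`. -/
structure Hom (s t : FactObj p q a b) where
  /-- The 1-cell of `P`. -/
  h : s.x ⟶ t.x
  /-- The 2-cell of `B`. -/
  h₁ : s.y ⟶ q.map h ≫ t.y
  /-- The 2-cell of `A`. -/
  h₂ : s.z ≫ p.map h ⟶ t.z

theorem Hom.mk_congr {s t : FactObj p q a b} {h h' : s.x ⟶ t.x} (e : h = h')
    {h₁ : s.y ⟶ q.map h ≫ t.y} {h₁' : s.y ⟶ q.map h' ≫ t.y}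
    {h₂ : s.z ≫ p.map h ⟶ t.z} {h₂' : s.z ≫ p.map h' ⟶ t.z}
    (e₁ : h₁ ≫ eqToHom (by rw [e]) = h₁') (e₂ : h₂ = eqToHom (by rw [e]) ≫ h₂') :
    Hom.mk h h₁ h₂ = Hom.mk h' h₁' h₂' := by
  subst e
  simp_all

variable [Strict P] [Strict A] [Strict B]

/-- The identity of `ℱ(φ,a,b)`, with identity 2-cells. -/
def Hom.id (s : FactObj p q a b) : Hom s s where
  h := 𝟙 s.x
  h₁ := eqToHom (by rw [q.map_id, Strict.id_comp])
  h₂ := eqToHom (by rw [p.map_id, Strict.comp_id])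

/-- Composition in `ℱ(φ,a,b)`, by pasting of 2-cells. -/
def Hom.comp {s t u : FactObj p q a b} (k : Hom s t) (l : Hom t u) : Hom s u where
  h := k.h ≫ l.h
  h₁ := k.h₁ ≫ q.map k.h ◁ l.h₁ ≫ eqToHom (by rw [q.map_comp, Strict.assoc])
  h₂ := eqToHom (by rw [p.map_comp, Strict.assoc]) ≫ k.h₂ ▷ p.map l.h ≫ l.h₂

theorem whiskerLeft_congr {X : Type u₁} [Bicategory.{w₁, v₁} X] {x y z : X} {h h' : x ⟶ y}
    (e : h = h') {k l : y ⟶ z} (η : k ⟶ l) :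
    h ◁ η = eqToHom (by rw [e]) ≫ h' ◁ η ≫ eqToHom (by rw [e]) := by
  subst e; simp

theorem whiskerRight_congr {X : Type u₁} [Bicategory.{w₁, v₁} X] {x y z : X} {h h' : y ⟶ z}
    (e : h = h') {k l : x ⟶ y} (η : k ⟶ l) :
    η ▷ h = eqToHom (by rw [e]) ≫ η ▷ h' ≫ eqToHom (by rw [e]) := by
  subst e; simp

instance : Category (FactObj p q a b) where
  Hom := Hom
  id := Hom.id
  comp := Hom.comp
  id_comp {s t} k := by
    refine Hom.mk_congr (Strict.id_comp _) ?_ ?_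
    · dsimp only [Hom.id, Hom.comp]
      generalize_proofs
      simp [whiskerLeft_congr (q.map_id _), Strict.leftUnitor_eqToIso]
    · dsimp only [Hom.id, Hom.comp]
      generalize_proofs
      simp
  comp_id {s t} k := by
    refine Hom.mk_congr (Strict.comp_id _) ?_ ?_
    · dsimp only [Hom.id, Hom.comp]
      generalize_proofs
      simp
    · dsimp only [Hom.id, Hom.comp]
      generalize_proofs
      simp [whiskerRight_congr (p.map_id _), Strict.rightUnitor_eqToIso]
  assoc {s t u v} k l m := by
    refine Hom.mk_congr (Strict.assoc _ _ _) ?_ ?_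
    · dsimp only [Hom.comp]
      generalize_proofs
      simp [whiskerLeft_congr (q.map_comp _ _), Strict.associator_eqToIso]
    · dsimp only [Hom.comp]
      generalize_proofs
      simp [whiskerRight_congr (p.map_comp _ _), Strict.associator_eqToIso]

end FactObj

namespace FactObj

variable {a : A} {b : B} (φ : LaxSquare p q f g)

/-- The object part of `𝒞(φ,a,b)`: the 1-cell `g y ∘ φ_x ∘ f z`. -/
def val (s : FactObj p q a b) : f.obj a ⟶ g.obj b :=
  f.map s.z ≫ φ.app s.x ≫ g.map s.y

theorem val_middle [Strict C] {x₁ x₂ : P} (h : x₁ ⟶ x₂) (y : q.obj x₂ ⟶ b) (z : a ⟶ p.obj x₁) :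
    f.map z ≫ φ.app x₁ ≫ g.map (q.map h ≫ y) = f.map (z ≫ p.map h) ≫ φ.app x₂ ≫ g.map y := by
  rw [f.map_comp, g.map_comp, Strict.assoc, ← Strict.assoc (φ.app x₁) _ (g.map y),
    ← φ.naturality, Strict.assoc]

/-- The morphism part of `𝒞(φ,a,b)`: the 2-cell obtained by pasting `g h₁` and `f h₂` with the
naturality square of `φ` at `h`. -/
def valMap [Strict C] {s t : FactObj p q a b} (k : Hom s t) : val φ s ⟶ val φ t :=
  f.map s.z ◁ φ.app s.x ◁ g.map₂ k.h₁ ≫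
    eqToHom (val_middle φ k.h t.y s.z) ≫
      f.map₂ k.h₂ ▷ (φ.app t.x ≫ g.map t.y)

end FactObj

section Aux

variable {X : Type u₁} [Bicategory.{w₁, v₁} X] {Y : Type u₂} [Bicategory.{w₂, v₂} Y]

theorem map₂_whiskerLeft_strict (F : StrictPseudofunctor X Y) {x y z : X} (h : x ⟶ y)
    {k l : y ⟶ z} (η : k ⟶ l) :
    F.map₂ (h ◁ η) =
      eqToHom (F.map_comp h k) ≫ F.map h ◁ F.map₂ η ≫ eqToHom (F.map_comp h l).symm := by
  rw [F.map₂_whisker_left, F.mapComp_eq_eqToIso, F.mapComp_eq_eqToIso]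
  rfl

theorem map₂_whiskerRight_strict (F : StrictPseudofunctor X Y) {x y z : X} {k l : x ⟶ y}
    (η : k ⟶ l) (h : y ⟶ z) :
    F.map₂ (η ▷ h) =
      eqToHom (F.map_comp k h) ≫ F.map₂ η ▷ F.map h ≫ eqToHom (F.map_comp l h).symm := by
  rw [F.map₂_whisker_right, F.mapComp_eq_eqToIso, F.mapComp_eq_eqToIso]
  rfl

theorem whiskerLeft_comp_strict [Strict X] {x y z t : X} (h : x ⟶ y) (k : y ⟶ z)
    {l m : z ⟶ t} (η : l ⟶ m) :
    h ◁ k ◁ η = eqToHom (Strict.assoc h k l).symm ≫ (h ≫ k) ◁ η ≫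
      eqToHom (Strict.assoc h k m) := by
  simp [Strict.associator_eqToIso]

theorem whiskerRight_comp_strict [Strict X] {x y z t : X} {l m : x ⟶ y} (η : l ⟶ m)
    (h : y ⟶ z) (k : z ⟶ t) :
    η ▷ h ▷ k = eqToHom (Strict.assoc l h k) ≫ η ▷ (h ≫ k) ≫
      eqToHom (Strict.assoc m h k).symm := by
  simp [Strict.associator_eqToIso]

end Aux

/-- The functor `𝒞(φ,a,b) : ℱ(φ,a,b) ⥤ C(fa,gb)`. -/
def factFunctor [Strict P] [Strict A] [Strict B] [Strict C]
    (φ : LaxSquare p q f g) (a : A) (b : B) :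
    FactObj p q a b ⥤ (f.obj a ⟶ g.obj b) where
  obj s := FactObj.val φ s
  map k := FactObj.valMap φ k
  map_id s := by
    change FactObj.valMap φ (FactObj.Hom.id s) = 𝟙 _
    dsimp only [FactObj.val, FactObj.valMap, FactObj.Hom.id]
    generalize_proofs
    simp only [PrelaxFunctor.map₂_eqToHom, eqToHom_whiskerRight, whiskerLeft_eqToHom,
      eqToHom_trans]
    simp only [eqToHom_refl]
  map_comp {s t u} k l := by
    change FactObj.valMap φ (FactObj.Hom.comp k l) = FactObj.valMap φ k ≫ FactObj.valMap φ l
    have e₁ : f.map s.z ≫ φ.app s.x ≫ g.map (q.map k.h) =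
        f.map (s.z ≫ p.map k.h) ≫ φ.app t.x := by
      rw [f.map_comp, Strict.assoc, φ.naturality]
    have e₂ : f.map (p.map l.h) ≫ φ.app u.x ≫ g.map u.y =
        φ.app t.x ≫ g.map (q.map l.h ≫ u.y) := by
      rw [g.map_comp, ← Strict.assoc, φ.naturality, Strict.assoc]
    have h₁ : f.map s.z ◁ φ.app s.x ◁ g.map₂ (q.map k.h ◁ l.h₁) =
        eqToHom (FactObj.val_middle φ k.h t.y s.z) ≫
          f.map (s.z ≫ p.map k.h) ◁ φ.app t.x ◁ g.map₂ l.h₁ ≫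
            eqToHom (FactObj.val_middle φ k.h _ s.z).symm := by
      simp only [map₂_whiskerLeft_strict, whiskerLeft_comp, whiskerLeft_comp_strict,
        FactObj.whiskerLeft_congr e₁, whiskerLeft_eqToHom, eqToHom_trans, eqToHom_trans_assoc,
        Category.assoc]
    have h₂ : f.map₂ (k.h₂ ▷ p.map l.h) ▷ (φ.app u.x ≫ g.map u.y) =
        eqToHom (FactObj.val_middle φ l.h u.y _).symm ≫
          f.map₂ k.h₂ ▷ (φ.app t.x ≫ g.map (q.map l.h ≫ u.y)) ≫
            eqToHom (FactObj.val_middle φ l.h u.y _) := by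
      simp only [map₂_whiskerRight_strict, comp_whiskerRight, whiskerRight_comp_strict,
        FactObj.whiskerRight_congr e₂, eqToHom_whiskerRight, eqToHom_trans, eqToHom_trans_assoc,
        Category.assoc]
    dsimp only [FactObj.val, FactObj.valMap, FactObj.Hom.comp]
    generalize_proofs
    simp only [PrelaxFunctor.map₂_comp, PrelaxFunctor.map₂_eqToHom, comp_whiskerRight,
      whiskerLeft_comp, h₁, h₂, Category.assoc, eqToHom_whiskerRight, whiskerLeft_eqToHom,
      eqToHom_trans, eqToHom_trans_assoc, whisker_exchange_assoc, eqToHom_refl,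
      Category.id_comp]

end LaxSquare

end PiZeroExact

/-!
A morphism of `ℱ(φ,a,b)` consists of a 1-cell of `P`, which is a generating relation of the coend
`∫^x π₀ B(qx,b) × π₀ A(a,px)`, and of 2-cells of `B` and `A`, which do not change the components of
the legs. So `π₀` of `ℱ(φ,a,b)` is this coend, and under this identification `π₀` of `𝒞(φ,a,b)` is
the map whose bijectivity defines `π₀`-exactness.
-/

namespace PiZeroExact

theorem zigzag_prodMk {J : Type u₁} [Category.{v₁} J] {K : Type u₂} [Category.{v₂} K]
    {j j' : J} {k k' : K} (hj : Zigzag j j') (hk : Zigzag k k') : Zigzag (j, k) (j', k') :=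
  (zigzag_obj_of_zigzag (Prod.sectL J k) hj).trans (zigzag_obj_of_zigzag (Prod.sectR j' K) hk)

section Comparison

variable {P : Type u₁} [Bicategory.{w₁, v₁} P] [Strict P]
  {A : Type u₂} [Bicategory.{w₂, v₂} A] [Strict A]
  {B : Type u₃} [Bicategory.{w₃, v₃} B] [Strict B]
  {C : Type u₄} [Bicategory.{w₄, v₄} C] [Strict C]
  {p : StrictPseudofunctor P A} {q : StrictPseudofunctor P B}
  {f : StrictPseudofunctor A C} {g : StrictPseudofunctor B C} {a : A} {b : B}

namespace FactObj

/-- The inclusion into `ℱ(φ,a,b)` of its fibre over an object `x` of `P`. -/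
def fiberInclusion (p : StrictPseudofunctor P A) (q : StrictPseudofunctor P B) (a : A) (b : B)
    (x : P) : (q.obj x ⟶ b) × (a ⟶ p.obj x) ⥤ FactObj p q a b where
  obj s := ⟨x, s.1, s.2⟩
  map k :=
    { h := 𝟙 x
      h₁ := k.1 ≫ eqToHom (by rw [q.map_id, Strict.id_comp])
      h₂ := eqToHom (by rw [p.map_id, Strict.comp_id]) ≫ k.2 }
  map_id s := Hom.mk_congr rfl (by simp) (by simp)
  map_comp k l := by
    refine Hom.mk_congr (Strict.id_comp _).symm ?_ ?_
    · simp [whiskerLeft_congr (q.map_id _), Strict.leftUnitor_eqToIso]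
    · simp [whiskerRight_congr (p.map_id _), Strict.rightUnitor_eqToIso]

end FactObj

/-- The component of `ℱ(φ,a,b)` determined by components of 1-cells `qx ⟶ b` and `a ⟶ px`. -/
def componentOfLegs {x : P} (s : CategoryTheory.ConnectedComponents (q.obj x ⟶ b))
    (t : CategoryTheory.ConnectedComponents (a ⟶ p.obj x)) :
    CategoryTheory.ConnectedComponents (FactObj p q a b) :=
  Quotient.map₂ (fun y z => ⟨x, y, z⟩)
    (fun _ _ hy _ _ hz =>
      zigzag_obj_of_zigzag (FactObj.fiberInclusion p q a b x) (zigzag_prodMk hy hz)) s t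

theorem componentOfLegs_dinatural {x₁ x₂ : P} (h : x₁ ⟶ x₂) (y : q.obj x₂ ⟶ b)
    (z : a ⟶ p.obj x₁) :
    componentOfLegs (PiZeroStar.cc (q.map h ≫ y)) (PiZeroStar.cc z) =
      componentOfLegs (PiZeroStar.cc y) (PiZeroStar.cc (z ≫ p.map h)) :=
  Quotient.sound (Zigzag.of_hom (FactObj.Hom.mk h (𝟙 _) (𝟙 _)))

/-- The element of the coend `∫^x π₀ B(qx,b) × π₀ A(a,px)` represented by components of 1-cells
`qx ⟶ b` and `a ⟶ px`. -/
def profCompMk {x : P} (s : CategoryTheory.ConnectedComponents (q.obj x ⟶ b))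
    (t : CategoryTheory.ConnectedComponents (a ⟶ p.obj x)) :
    ProfComp (PiZeroStar.map p) (PiZeroStar.map q) ⟨a⟩ ⟨b⟩ :=
  Quot.mk _ ⟨⟨x⟩, (s, t)⟩

theorem profCompMk_dinatural {x₁ x₂ : P} (h : x₁ ⟶ x₂) (y : q.obj x₂ ⟶ b) (z : a ⟶ p.obj x₁) :
    profCompMk (PiZeroStar.cc (q.map h ≫ y)) (PiZeroStar.cc z) =
      profCompMk (PiZeroStar.cc y) (PiZeroStar.cc (z ≫ p.map h)) :=
  Quot.sound (CoendRel.intro (p := PiZeroStar.map p) (q := PiZeroStar.map q)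
    (x₁ := ⟨x₁⟩) (x₂ := ⟨x₂⟩) (PiZeroStar.cc h) (PiZeroStar.cc y) (PiZeroStar.cc z))

theorem profCompMk_eq_of_hom {s t : FactObj p q a b} (k : s ⟶ t) :
    profCompMk (PiZeroStar.cc s.y) (PiZeroStar.cc s.z) =
      profCompMk (PiZeroStar.cc t.y) (PiZeroStar.cc t.z) := by
  have hy : PiZeroStar.cc s.y = PiZeroStar.cc (q.map k.h ≫ t.y) :=
    Quotient.sound (Zigzag.of_hom k.h₁)
  have hz : PiZeroStar.cc (s.z ≫ p.map k.h) = PiZeroStar.cc t.z :=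
    Quotient.sound (Zigzag.of_hom k.h₂)
  rw [hy, profCompMk_dinatural, hz]

/-- The set of connected components of `ℱ(φ,a,b)` is the coend `∫^x π₀ B(qx,b) × π₀ A(a,px)`. -/
def componentsEquivProfComp (p : StrictPseudofunctor P A) (q : StrictPseudofunctor P B)
    (a : A) (b : B) :
    CategoryTheory.ConnectedComponents (FactObj p q a b) ≃
      ProfComp (PiZeroStar.map p) (PiZeroStar.map q) ⟨a⟩ ⟨b⟩ where
  toFun := CategoryTheory.ConnectedComponents.liftFunctor _
    { obj s := Discrete.mk (profCompMk (PiZeroStar.cc s.y) (PiZeroStar.cc s.z))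
      map k := Discrete.eqToHom (profCompMk_eq_of_hom k) }
  invFun := Quot.lift (fun s => componentOfLegs s.2.1 s.2.2) (by
    rintro _ _ ⟨⟨h⟩, ⟨y⟩, ⟨z⟩⟩
    exact componentOfLegs_dinatural h y z)
  left_inv := by
    rintro ⟨s⟩
    rfl
  right_inv := by
    rintro ⟨x, ⟨y⟩, ⟨z⟩⟩
    rfl

theorem profTrans_comp_componentsEquivProfComp (φ : LaxSquare p q f g) (a : A) (b : B) :
    profTrans (piZeroStarSquare φ) ⟨a⟩ ⟨b⟩ ∘ componentsEquivProfComp p q a b =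
      (factFunctor φ a b).mapConnectedComponents := by
  funext s
  obtain ⟨s⟩ := s
  rfl

theorem invertedByPiZero_factFunctor_iff (φ : LaxSquare p q f g) (a : A) (b : B) :
    InvertedByPiZero (factFunctor φ a b) ↔
      Function.Bijective (profTrans (piZeroStarSquare φ) ⟨a⟩ ⟨b⟩) := by
  rw [InvertedByPiZero, ← profTrans_comp_componentsEquivProfComp]
  exact (componentsEquivProfComp p q a b).bijective_comp _

end Comparison

end PiZeroExact

/-- A lax square of 2-categories is `π₀`-exact if and only if for all objects `a` and `b` the
functor `𝒞(φ,a,b) : ℱ(φ,a,b) ⥤ C(fa,gb)` is inverted by `π₀`. -/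
theorem proposition5p17
    {P : Type u₁} [Bicategory.{w₁, v₁} P] [Bicategory.Strict P]
    {A : Type u₂} [Bicategory.{w₂, v₂} A] [Bicategory.Strict A]
    {B : Type u₃} [Bicategory.{w₃, v₃} B] [Bicategory.Strict B]
    {C : Type u₄} [Bicategory.{w₄, v₄} C] [Bicategory.Strict C]
    (p : StrictPseudofunctor P A) (q : StrictPseudofunctor P B)
    (f : StrictPseudofunctor A C) (g : StrictPseudofunctor B C)
    (φ : PiZeroExact.LaxSquare p q f g) :
    PiZeroExact.IsPiZeroExact φ ↔
      ∀ (a : A) (b : B), PiZeroExact.InvertedByPiZero (PiZeroExact.factFunctor φ a b) :=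
  ⟨fun h a b => (PiZeroExact.invertedByPiZero_factFunctor_iff φ a b).2 (h ⟨a⟩ ⟨b⟩),
    fun h a b => (PiZeroExact.invertedByPiZero_factFunctor_iff φ a.as b.as).1 (h a.as b.as)⟩
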